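/- Let $k\ge 2$ be an integer and let $G$ be a finite $k$-uniform hypergraph ($k$-graph): a finite vertex set $V(G)$ and a set $E(G)$ of edges, each edge being a $k$-element subset of $V(G)$. Assume that $G$ is connected, i.e. that any two vertices $u,v$ are joined by a path $(v_0,e_1,v_1,\dots,e_\ell,v_\ell)$ with $v_0=u$, $v_\ell=v$, pairwise distinct vertices $v_i$, pairwise distinct edges $e_i\in E(G)$, and $v_{i-1},v_i\in e_i$ for $1\le i\le \ell$. The degree of a vertex is the number of edges containing it; let $\Delta$ be the maximum degree of $G$ and assume $\Delta\ge 2$. A matching is a set of pairwise disjoint edges; let $p(G,r)$ be the number of matchings with exactly $r$ edges (so $p(G,0)=1$), and let $$\mu(G,x)=\sum_{r\ge 0}(-1)^r\,p(G,r)\,x^{|V(G)|-kr}$$ be the matching polynomial of $G$. Let $\lambda(G)$ be the maximum modulus of the complex zeros of $\mu(G,x)$. Then $$\lambda(G)<\frac{k}{k-1}\bigl((k-1)(\Delta-1)\bigr)^{1/k}.$$ -/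

import Mathlib

namespace Hypergraph

/-- A `k`-graph: a finite `k`-uniform hypergraph with `k ≥ 2`. -/
structure IsKGraph {α : Type*} (H : Hypergraph α) (k : ℕ) : Prop where
  two_le : 2 ≤ k
  finite_vertexSet : H.vertexSet.Finite
  ncard_edge : ∀ e ∈ H.edgeSet, e.ncard = k

/-- The number of edges incident with the vertex `v`. -/
noncomputable def degree {α : Type*} (H : Hypergraph α) (v : α) : ℕ :=
  {e | e ∈ H.edgeSet ∧ v ∈ e}.ncard

/-- The maximum degree of a vertex of `H` (for finite `H`, the supremum is over a finite set). -/
noncomputable def maxDegree {α : Type*} (H : Hypergraph α) : ℕ :=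
  sSup (H.degree '' H.vertexSet)

/-- The sequence `(w 0, e 0, w 1, e 1, …, e (l - 1), w l)` is a path of `H`: its vertices are
distinct, its edges are distinct, and each edge contains the vertices before and after it. -/
structure IsPath {α : Type*} (H : Hypergraph α) {l : ℕ} (w : Fin (l + 1) → α)
    (e : Fin l → Set α) : Prop where
  vertex_mem : ∀ i, w i ∈ H.vertexSet
  edge_mem : ∀ i, e i ∈ H.edgeSet
  vertex_injective : Function.Injective w
  edge_injective : Function.Injective e
  incident : ∀ i : Fin l, w i.castSucc ∈ e i ∧ w i.succ ∈ e i

/-- Any two vertices of `H` are connected by a path. -/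
def IsConnected {α : Type*} (H : Hypergraph α) : Prop :=
  ∀ u ∈ H.vertexSet, ∀ v ∈ H.vertexSet, ∃ (l : ℕ) (w : Fin (l + 1) → α) (e : Fin l → Set α),
    H.IsPath w e ∧ w 0 = u ∧ w (Fin.last l) = v

/-- A set of edges, no two distinct ones of which share a vertex. -/
def IsMatching {α : Type*} (H : Hypergraph α) (M : Set (Set α)) : Prop :=
  M ⊆ H.edgeSet ∧ ∀ e ∈ M, ∀ f ∈ M, e ≠ f → Disjoint e f

/-- The number `p(H, r)` of matchings of `H` with exactly `r` edges. -/
noncomputable def numMatchings {α : Type*} (H : Hypergraph α) (r : ℕ) : ℕ :=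
  {M | H.IsMatching M ∧ M.ncard = r}.ncard

/-- The matching polynomial `μ(H, x) = ∑ r ≥ 0, (-1) ^ r * p(H, r) * x ^ (|V(H)| - k * r)` of a
`k`-graph. There is no matching with more than `|E(H)|` edges, so the sum stops there. If
`k * r > |V(H)|` then `p(H, r) = 0`, so truncated subtraction in the exponent is harmless. -/
noncomputable def matchingPolynomial {α : Type*} (H : Hypergraph α) (k : ℕ) : Polynomial ℤ :=
  ∑ r ∈ Finset.range (H.edgeSet.ncard + 1),
    Polynomial.C ((-1) ^ r * (H.numMatchings r : ℤ)) *
      Polynomial.X ^ (H.vertexSet.ncard - k * r)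

/-- The set of moduli of the complex zeros of the matching polynomial. -/
def zeroModuli {α : Type*} (H : Hypergraph α) (k : ℕ) : Set ℝ :=
  {t | ∃ z : ℂ, Polynomial.aeval z (H.matchingPolynomial k) = 0 ∧ ‖z‖ = t}

/-- `λ(H)`, the maximum modulus of the complex zeros of the matching polynomial. -/
noncomputable def matchingRadius {α : Type*} (H : Hypergraph α) (k : ℕ) : ℝ :=
  sSup (H.zeroModuli k)

theorem IsKGraph.finite_edgeSet {α : Type*} {H : Hypergraph α} {k : ℕ} (h : H.IsKGraph k) :
    H.edgeSet.Finite :=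
  h.finite_vertexSet.powerset.subset H.edgeSet_subset_powerset_vertexSet

theorem IsKGraph.numMatchings_zero {α : Type*} {H : Hypergraph α} {k : ℕ} (h : H.IsKGraph k) :
    H.numMatchings 0 = 1 := by
  have : {M | H.IsMatching M ∧ M.ncard = 0} = {∅} := by
    ext M
    simp only [Set.mem_ofPred_eq, Set.mem_singleton_iff]
    constructor
    · rintro ⟨hM, h0⟩
      exact (Set.ncard_eq_zero (h.finite_edgeSet.subset hM.1)).1 h0
    · rintro rfl
      simp [IsMatching]
  rw [numMatchings, this, Set.ncard_singleton]

theorem IsKGraph.coeff_matchingPolynomial {α : Type*} {H : Hypergraph α} {k : ℕ}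
    (h : H.IsKGraph k) (hV : H.vertexSet.Nonempty) :
    (H.matchingPolynomial k).coeff H.vertexSet.ncard = 1 := by
  have hpos : 0 < H.vertexSet.ncard := (Set.ncard_pos h.finite_vertexSet).2 hV
  have hk := h.two_le
  rw [matchingPolynomial, Polynomial.finsetSum_coeff, Finset.sum_eq_single 0]
  · simp [h.numMatchings_zero]
  · intro r _ hr
    have hkr : 0 < k * r := Nat.mul_pos (by omega) (by omega)
    rw [Polynomial.coeff_C_mul, Polynomial.coeff_X_pow, if_neg (by omega), mul_zero]
  · simp

/-- For a `k`-graph with at least one vertex the maximum in the definition of `λ(H)` exists. -/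
theorem IsKGraph.isGreatest_matchingRadius {α : Type*} {H : Hypergraph α} {k : ℕ}
    (h : H.IsKGraph k) (hV : H.vertexSet.Nonempty) :
    IsGreatest (H.zeroModuli k) (H.matchingRadius k) := by
  have hc := h.coeff_matchingPolynomial hV
  have hpos : 0 < H.vertexSet.ncard := (Set.ncard_pos h.finite_vertexSet).2 hV
  set P : Polynomial ℂ := (H.matchingPolynomial k).map (algebraMap ℤ ℂ) with hP
  have hPc : P.coeff H.vertexSet.ncard = 1 := by simp [hP, hc]
  have hP0 : P ≠ 0 := fun h0 => by simp [h0] at hPc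
  have hdeg : P.degree ≠ 0 := by
    have := Polynomial.le_natDegree_of_ne_zero (p := P) (n := H.vertexSet.ncard) (by simp [hPc])
    intro hd
    have h0 : P.natDegree = 0 := Polynomial.natDegree_eq_of_degree_eq_some hd
    omega
  have heq : H.zeroModuli k = (fun z : ℂ => ‖z‖) '' P.rootSet ℂ := by
    have hz (z : ℂ) :
        z ∈ P.rootSet ℂ ↔ Polynomial.aeval z (H.matchingPolynomial k) = 0 := by
      rw [Polynomial.mem_rootSet, hP, Polynomial.aeval_map_algebraMap]
      exact and_iff_right hP0
    ext t
    simp only [zeroModuli, Set.mem_ofPred_eq, Set.mem_image, hz]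
  obtain ⟨z, hz⟩ := Complex.isAlgClosed.exists_root P hdeg
  have hfin : (H.zeroModuli k).Finite := by
    rw [heq]; exact (Polynomial.rootSet_finite P ℂ).image _
  have hne : (H.zeroModuli k).Nonempty := by
    rw [heq]
    exact ⟨_, z, by simpa [Polynomial.mem_rootSet, hP0] using hz, rfl⟩
  exact ⟨hne.csSup_mem hfin, fun t ht => le_csSup hfin.bddAbove ht⟩

end Hypergraph

namespace Hypergraph

/-! Write μ(S) for the value at z of the matching polynomial induced on S, and put d = Δ - 1. Fix c
≥ 1 and suppose |z| ≥ c + d / c^(k-1). Induction on |S| proves two claims together: μ(S) ≠ 0, and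
deleting a vertex of degree at most d shrinks |μ| by a factor greater than c. The deletion
recurrence `matchingSum_eq` gives μ(S) = z μ(S - v) - ∑ μ(S \ e) over the edges e at v. Once v is
gone, the other k - 1 vertices of e have lost e, so their degrees are at most d. Deleting them one
at a time yields |μ(S \ e)| < |μ(S - v)| / c^(k-1), which closes the induction in
`matchingSum_ne_zero_and_lt`. The choice c^k = (k-1)d minimises c + d / c^(k-1) and turns it into
the stated bound. Strictness in each deletion excludes zeros on the bounding circle too. -/

open scoped Classical in
/-- The matchings contained in `E` all of whose members lie inside the vertex set `S`. -/
noncomputable def matchingsWithin {α : Type*} (E : Finset (Set α)) (S : Set α) :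
    Finset (Finset (Set α)) :=
  E.powerset.filter fun m =>
    (∀ e ∈ m, e ⊆ S) ∧ (m : Set (Set α)).PairwiseDisjoint id

open scoped Classical in
/-- The members of `E` that contain `v` and lie inside `S`. -/
noncomputable def starWithin {α : Type*} (E : Finset (Set α)) (S : Set α) (v : α) :
    Finset (Set α) :=
  E.filter fun e => v ∈ e ∧ e ⊆ S

/-- The value at `z` of the matching polynomial of the `k`-graph induced by `E` on `S`. -/
noncomputable def matchingSum {α : Type*} (E : Finset (Set α)) (k : ℕ) (z : ℂ) (S : Set α) : ℂ :=
  ∑ m ∈ matchingsWithin E S, (-1) ^ m.card * z ^ (S.ncard - k * m.card)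

/-! ### Matchings inside a vertex set and the deletion recurrence -/

section

variable {α : Type*} {E : Finset (Set α)} {S T : Set α} {k : ℕ} {z : ℂ}

theorem mem_matchingsWithin {m : Finset (Set α)} :
    m ∈ matchingsWithin E S ↔
      m ⊆ E ∧ (∀ e ∈ m, e ⊆ S) ∧ (m : Set (Set α)).PairwiseDisjoint id := by
  simp [matchingsWithin]

theorem mem_starWithin {v : α} {e : Set α} : e ∈ starWithin E S v ↔ e ∈ E ∧ v ∈ e ∧ e ⊆ S := by
  simp [starWithin]

open scoped Classical in
theorem insert_mem_matchingsWithin {m : Finset (Set α)} {e : Set α} (he : e ∉ m) :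
    insert e m ∈ matchingsWithin E S ↔ e ∈ E ∧ e ⊆ S ∧ m ∈ matchingsWithin E (S \ e) := by
  simp only [mem_matchingsWithin, Finset.insert_subset_iff, Finset.forall_mem_insert,
    Finset.coe_insert, Set.subset_sdiff]
  rw [Set.pairwiseDisjoint_insert_of_notMem (by simpa using he)]
  simp only [id, Finset.mem_coe]
  constructor
  · rintro ⟨⟨h1, h2⟩, ⟨h3, h4⟩, h5, h6⟩
    exact ⟨h1, h3, h2, fun f hf => ⟨h4 f hf, (h6 f hf).symm⟩, h5⟩
  · rintro ⟨h1, h3, h2, h4, h5⟩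
    exact ⟨⟨h1, h2⟩, ⟨h3, fun f hf => (h4 f hf).1⟩, h5, fun f hf => (h4 f hf).2.symm⟩

/-- Ensures that the natural subtraction in the exponent does not truncate, so that a factor `z` can
be split off when a vertex is deleted. -/
theorem mul_card_le_ncard (hE : ∀ e ∈ E, e.ncard = k) (m : Finset (Set α)) :
    ∀ S : Set α, S.Finite → m ∈ matchingsWithin E S → k * m.card ≤ S.ncard := by
  classical
  induction m using Finset.induction_on with
  | empty => simp
  | insert e m he ih =>
    intro S hS hm
    obtain ⟨h1, h2, h3⟩ := (insert_mem_matchingsWithin he).1 hm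
    have h4 := ih _ (hS.subset Set.sdiff_subset) h3
    have h5 := Set.ncard_sdiff_add_ncard_of_subset h2 hS
    rw [Finset.card_insert_of_notMem he, mul_add, mul_one]
    have := hE e h1
    omega

theorem matchingSum_empty (hE : ∀ e ∈ E, e.Nonempty) : matchingSum E k z ∅ = 1 := by
  have : matchingsWithin E (∅ : Set α) = {∅} := by
    ext m
    rw [mem_matchingsWithin, Finset.mem_singleton]
    constructor
    · rintro ⟨h1, h2, -⟩
      refine Finset.eq_empty_of_forall_notMem fun e he => ?_
      exact (hE e (h1 he)).ne_empty (Set.subset_empty_iff.1 (h2 e he))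
    · rintro rfl
      simp
  simp [matchingSum, this]

/-- Deletion recurrence: a matching either misses `v` or covers it by exactly one edge. -/
theorem matchingSum_eq (hE : ∀ e ∈ E, e.ncard = k) (hS : S.Finite) {v : α} (hv : v ∈ S) :
    matchingSum E k z S = z * matchingSum E k z (S \ {v}) -
      ∑ e ∈ starWithin E S v, matchingSum E k z (S \ e) := by
  classical
  rw [matchingSum, ← Finset.sum_filter_add_sum_filter_not _ (fun m => ∀ e ∈ m, v ∉ e),
    sub_eq_add_neg]
  congr 1
  · rw [matchingSum, Finset.mul_sum]
    have hfil : (matchingsWithin E S).filter (fun m => ∀ e ∈ m, v ∉ e) =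
        matchingsWithin E (S \ {v}) := by
      ext m
      simp only [Finset.mem_filter, mem_matchingsWithin, Set.subset_sdiff,
        Set.disjoint_singleton_right]
      constructor
      · rintro ⟨⟨h1, h2, h3⟩, h4⟩
        exact ⟨h1, fun e he => ⟨h2 e he, h4 e he⟩, h3⟩
      · rintro ⟨h1, h2, h3⟩
        exact ⟨⟨h1, fun e he => (h2 e he).1, h3⟩, fun e he => (h2 e he).2⟩
    rw [hfil]
    refine Finset.sum_congr rfl fun m hm => ?_
    have h1 := mul_card_le_ncard hE m _ (hS.subset Set.sdiff_subset) hm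
    have h2 := Set.ncard_sdiff_singleton_add_one hv hS
    rw [show S.ncard - k * m.card = (S \ {v}).ncard - k * m.card + 1 by omega, pow_succ]
    ring
  · simp only [matchingSum]
    rw [← Finset.sum_neg_distrib]
    simp only [← Finset.sum_neg_distrib]
    rw [Finset.sum_sigma']
    have hnot : ∀ e : Set α, v ∈ e → ∀ m ∈ matchingsWithin E (S \ e), ∀ f ∈ m, v ∉ f :=
      fun e hve m hm f hf hvf => ((mem_matchingsWithin.1 hm).2.1 f hf hvf).2 hve
    symm
    -- A matching covering `v` is a unique edge `e` at `v` together with a matching of `S \ e`.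
    refine Finset.sum_bij (fun p _ => insert p.1 p.2) ?_ ?_ ?_ ?_
    · rintro ⟨e, m⟩ hp
      obtain ⟨he, hm⟩ := Finset.mem_sigma.1 hp
      obtain ⟨h1, h2, h3⟩ := mem_starWithin.1 he
      have hem : e ∉ m := fun h => hnot e h2 m hm e h h2
      refine Finset.mem_filter.2 ⟨(insert_mem_matchingsWithin hem).2 ⟨h1, h3, hm⟩, fun h => ?_⟩
      exact h e (Finset.mem_insert_self _ _) h2
    · rintro ⟨e, m⟩ hp ⟨f, n⟩ hq h
      obtain ⟨he, hm⟩ := Finset.mem_sigma.1 hp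
      obtain ⟨hf, hn⟩ := Finset.mem_sigma.1 hq
      obtain ⟨-, hve, -⟩ := mem_starWithin.1 he
      obtain ⟨-, hvf, -⟩ := mem_starWithin.1 hf
      dsimp only at h hve hvf hm hn
      have hem : e ∉ m := fun h => hnot e hve m hm e h hve
      have hfn : f ∉ n := fun h => hnot f hvf n hn f h hvf
      have hef : e = f := by
        rcases Finset.mem_insert.1 (h ▸ Finset.mem_insert_self e m) with h' | h'
        · exact h'
        · exact absurd hve (hnot f hvf n hn e h')
      subst hef
      have : m = n := by
        rw [← Finset.erase_insert hem, h, Finset.erase_insert hfn]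
      rw [this]
    · intro m hm
      obtain ⟨hm, hv'⟩ := Finset.mem_filter.1 hm
      push Not at hv'
      obtain ⟨e, he, hve⟩ := hv'
      have h := hm
      rw [← Finset.insert_erase he, insert_mem_matchingsWithin (Finset.notMem_erase e m)] at h
      exact ⟨⟨e, m.erase e⟩,
        Finset.mem_sigma.2 ⟨mem_starWithin.2 ⟨h.1, hve, h.2.1⟩, h.2.2⟩, Finset.insert_erase he⟩
    · rintro ⟨e, m⟩ hp
      obtain ⟨he, hm⟩ := Finset.mem_sigma.1 hp
      obtain ⟨h1, h2, h3⟩ := mem_starWithin.1 he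
      dsimp only at h1 h2 h3 hm ⊢
      have hem : e ∉ m := fun h => hnot e h2 m hm e h h2
      have h5 := Set.ncard_sdiff_add_ncard_of_subset h3 hS
      rw [Finset.card_insert_of_notMem hem, mul_add, mul_one, ← h5, hE e h1, Nat.sub_add_eq,
        Nat.sub_right_comm, Nat.add_sub_cancel, pow_succ]
      ring

/-! ### Growth estimates and non-vanishing -/

/-- If deleting low-degree vertices shrinks `matchingSum` by a factor of at least `c`, then
deleting a set `T` of such vertices shrinks it by a factor of at least `c ^ |T|`. -/
theorem pow_mul_norm_matchingSum_diff_le {c : ℝ} {d : ℕ} (hc : 0 < c)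
    (h : ∀ S' ⊆ S, ∀ u ∈ S', (starWithin E S' u).card ≤ d →
      c * ‖matchingSum E k z (S' \ {u})‖ < ‖matchingSum E k z S'‖)
    (hT : T.Finite) (hTS : T ⊆ S) (hd : ∀ u ∈ T, (starWithin E S u).card ≤ d) :
    c ^ T.ncard * ‖matchingSum E k z (S \ T)‖ ≤ ‖matchingSum E k z S‖ ∧
      (T.Nonempty → c ^ T.ncard * ‖matchingSum E k z (S \ T)‖ < ‖matchingSum E k z S‖) := by
  induction T, hT using Set.Finite.induction_on with
  | empty => simp
  | @insert a T ha hT ih =>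
    obtain ⟨ih, -⟩ := ih ((Set.subset_insert _ _).trans hTS)
      fun u hu => hd u (Set.mem_insert_of_mem _ hu)
    have hlt : c ^ (insert a T).ncard * ‖matchingSum E k z (S \ insert a T)‖ <
        ‖matchingSum E k z S‖ := by
      refine lt_of_lt_of_le ?_ ih
      have hsub : S \ T ⊆ S := Set.sdiff_subset
      have hda : (starWithin E (S \ T) a).card ≤ d := by
        refine (Finset.card_le_card fun e he => ?_).trans (hd a (Set.mem_insert _ _))
        rw [mem_starWithin] at he ⊢
        exact ⟨he.1, he.2.1, he.2.2.trans hsub⟩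
      have := h (S \ T) hsub a ⟨hTS (Set.mem_insert _ _), ha⟩ hda
      rw [Set.sdiff_sdiff, Set.union_singleton] at this
      rw [Set.ncard_insert_of_notMem ha hT, pow_succ, mul_assoc]
      exact mul_lt_mul_of_pos_left this (pow_pos hc _)
    exact ⟨hlt.le, fun _ => hlt⟩

/-- The two claims need each other: the ratio bound for `S` divides out a nonzero value on a smaller
set, and non-vanishing on `S` uses ratio bounds on smaller sets. -/
theorem matchingSum_ne_zero_and_lt {c : ℝ} {d : ℕ} (hk : 2 ≤ k) (hE : ∀ e ∈ E, e.ncard = k)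
    (hc : 1 ≤ c) (hd : 1 ≤ d) (hz : c + d / c ^ (k - 1) ≤ ‖z‖) (n : ℕ) :
    ∀ S : Set α, S.Finite → S.ncard = n → (∀ v ∈ S, (starWithin E S v).card ≤ d + 1) →
      matchingSum E k z S ≠ 0 ∧ ∀ u ∈ S, (starWithin E S u).card ≤ d →
        c * ‖matchingSum E k z (S \ {u})‖ < ‖matchingSum E k z S‖ := by
  induction n using Nat.strong_induction_on with
  | _ n ih =>
  intro S hS hn hdeg
  have hc0 : 0 < c := by linarith
  have hq : 1 ≤ c ^ (k - 1) := one_le_pow₀ hc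
  have hq0 : 0 < c ^ (k - 1) := by linarith
  have hd0 : (1 : ℝ) ≤ d := by exact_mod_cast hd
  have hmono : ∀ S' ⊆ S, ∀ v, (starWithin E S' v).card ≤ (starWithin E S v).card := by
    intro S' hS' v
    refine Finset.card_le_card fun e he => ?_
    rw [mem_starWithin] at he ⊢
    exact ⟨he.1, he.2.1, he.2.2.trans hS'⟩
  have ih' : ∀ S' ⊂ S, matchingSum E k z S' ≠ 0 ∧ ∀ u ∈ S', (starWithin E S' u).card ≤ d →
      c * ‖matchingSum E k z (S' \ {u})‖ < ‖matchingSum E k z S'‖ := fun S' hS' =>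
    ih _ (hn ▸ Set.ncard_lt_ncard hS' hS) S' (hS.subset hS'.1) rfl
      fun v hv => (hmono S' hS'.1 v).trans (hdeg v (hS'.1 hv))
  -- Deleting any vertex `v` costs at least the factor `‖z‖ - (number of edges at `v`) / c ^ (k - 1)`.
  have key : ∀ v ∈ S, ∀ b : ℝ, b ≤ ‖z‖ - (starWithin E S v).card / c ^ (k - 1) → b < ‖z‖ →
      b * ‖matchingSum E k z (S \ {v})‖ < ‖matchingSum E k z S‖ := by
    intro v hv b hb hbz
    have hss : S \ {v} ⊂ S := Set.sdiff_singleton_ssubset.2 hv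
    set A := ‖matchingSum E k z (S \ {v})‖ with hA
    have hA0 : 0 < A := norm_pos_iff.2 (ih' _ hss).1
    have hedge : ∀ e ∈ starWithin E S v, ‖matchingSum E k z (S \ e)‖ < A / c ^ (k - 1) := by
      intro e he
      obtain ⟨heE, hve, heS⟩ := mem_starWithin.1 he
      have hefin : e.Finite := hS.subset heS
      have hcard := Set.ncard_sdiff_singleton_add_one hve hefin
      rw [hE e heE] at hcard
      have h1 : (e \ {v}).ncard = k - 1 := by omega
      have hne : (e \ {v}).Nonempty := by
        rw [← Set.ncard_pos (hefin.subset Set.sdiff_subset)]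
        omega
      -- The edge `e` itself disappears with `v`, so the degree of `u` drops from at most `d + 1` to
      -- at most `d`.
      have hlow : ∀ u ∈ e \ {v}, (starWithin E (S \ {v}) u).card ≤ d := by
        intro u hu
        have hlt : (starWithin E (S \ {v}) u).card < (starWithin E S u).card := by
          refine Finset.card_lt_card (Finset.ssubset_iff_of_subset ?_ |>.2 ⟨e, ?_, ?_⟩)
          · intro f hf
            rw [mem_starWithin] at hf ⊢
            exact ⟨hf.1, hf.2.1, hf.2.2.trans hss.1⟩
          · exact mem_starWithin.2 ⟨heE, hu.1, heS⟩
          · exact fun hf => ((mem_starWithin.1 hf).2.2 hve).2 rfl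
        have := hdeg u (heS hu.1)
        omega
      have h2 := (pow_mul_norm_matchingSum_diff_le hc0
        (fun S' hS' u hu hdu => (ih' S' (hS'.trans_ssubset hss)).2 u hu hdu)
        (hefin.subset Set.sdiff_subset) (Set.sdiff_subset_sdiff_left heS) hlow).2 hne
      have h3 : (S \ {v}) \ (e \ {v}) = S \ e := by
        rw [Set.sdiff_sdiff, Set.union_sdiff_cancel (Set.singleton_subset_iff.2 hve)]
      rw [h1, h3] at h2
      rw [lt_div_iff₀ hq0, mul_comm]
      exact h2
    have hsum : ‖∑ e ∈ starWithin E S v, matchingSum E k z (S \ e)‖ ≤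
        ∑ e ∈ starWithin E S v, ‖matchingSum E k z (S \ e)‖ := norm_sum_le _ _
    have htri : ‖z‖ * A - ‖∑ e ∈ starWithin E S v, matchingSum E k z (S \ e)‖ ≤
        ‖matchingSum E k z S‖ := by
      rw [matchingSum_eq hE hS hv, hA, ← norm_mul]
      exact norm_sub_norm_le _ _
    -- With no edge at `v` the sum supplies no strict inequality; strictness then comes from `b <
    -- ‖z‖`.
    rcases (starWithin E S v).eq_empty_or_nonempty with h0 | h0
    · rw [h0, Finset.sum_empty, norm_zero, sub_zero] at htri
      exact (mul_lt_mul_of_pos_right hbz hA0).trans_le htri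
    · have h4 := Finset.sum_lt_sum_of_nonempty h0 hedge
      rw [Finset.sum_const, nsmul_eq_mul] at h4
      have h5 := mul_le_mul_of_nonneg_right hb hA0.le
      have h6 : (‖z‖ - (starWithin E S v).card / c ^ (k - 1)) * A =
          ‖z‖ * A - (starWithin E S v).card * (A / c ^ (k - 1)) := by ring
      linarith
  constructor
  · rcases S.eq_empty_or_nonempty with rfl | ⟨v, hv⟩
    · rw [matchingSum_empty fun e he => Set.nonempty_of_ncard_ne_zero (by rw [hE e he]; omega)]
      exact one_ne_zero
    -- A vertex of degree `d + 1` costs one extra `1 / c ^ (k - 1) ≤ 1 ≤ c`, so the factor `b = 0`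
    -- is still available.
    · have h1 : ((starWithin E S v).card : ℝ) ≤ d + 1 := by exact_mod_cast hdeg v hv
      have h2 : ((starWithin E S v).card : ℝ) / c ^ (k - 1) ≤ (d + 1) / c ^ (k - 1) := by gcongr
      have h3 : 1 / c ^ (k - 1) ≤ 1 := (div_le_one hq0).2 hq
      rw [add_div] at h2
      have h4 : 0 < d / c ^ (k - 1) := by positivity
      have := key v hv 0 (by linarith) (by linarith)
      rw [zero_mul] at this
      exact norm_pos_iff.1 this
  · intro u hu hdu
    have h1 : ((starWithin E S u).card : ℝ) ≤ d := by exact_mod_cast hdu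
    have h2 : ((starWithin E S u).card : ℝ) / c ^ (k - 1) ≤ d / c ^ (k - 1) := by gcongr
    have h4 : 0 < d / c ^ (k - 1) := by positivity
    exact key u hu c (by linarith) (by linarith)

end

/-! ### Transfer to the matching polynomial and choice of the constant -/

theorem IsKGraph.aeval_matchingPolynomial {α : Type*} {H : Hypergraph α} {k : ℕ}
    (h : H.IsKGraph k) (z : ℂ) :
    Polynomial.aeval z (H.matchingPolynomial k) =
      matchingSum h.finite_edgeSet.toFinset k z H.vertexSet := by
  classical
  set E := h.finite_edgeSet.toFinset with hEdef
  have hnum : ∀ r, H.numMatchings r =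
      ((matchingsWithin E H.vertexSet).filter fun m => m.card = r).card := by
    intro r
    rw [numMatchings, ← Set.ncard_coe_finset, ← Set.ncard_image_of_injective _
      (Finset.coe_injective : Function.Injective ((↑) : Finset (Set α) → Set (Set α)))]
    congr 1
    ext M
    simp only [Set.mem_ofPred_eq, Set.mem_image, Finset.coe_filter, mem_matchingsWithin]
    constructor
    · rintro ⟨⟨h1, h2⟩, h3⟩
      have hM := h.finite_edgeSet.subset h1
      refine ⟨hM.toFinset, ⟨⟨?_, ?_, ?_⟩, ?_⟩, hM.coe_toFinset⟩
      · exact fun e he => h.finite_edgeSet.mem_toFinset.2 (h1 (hM.mem_toFinset.1 he))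
      · exact fun e he => H.edgeSet_subset_powerset_vertexSet (h1 (hM.mem_toFinset.1 he))
      · rw [hM.coe_toFinset]
        exact fun e he f hf hef => h2 e he f hf hef
      · rw [← h3, Set.ncard_eq_toFinset_card M hM]
    · rintro ⟨m, ⟨⟨h1, -, h3⟩, h4⟩, rfl⟩
      refine ⟨⟨fun e he => h.finite_edgeSet.mem_toFinset.1 (h1 he), ?_⟩, ?_⟩
      · exact fun e he f hf hef => h3 he hf hef
      · rw [Set.ncard_coe_finset, h4]
  have hmaps : ∀ m ∈ matchingsWithin E H.vertexSet,
      m.card ∈ Finset.range (H.edgeSet.ncard + 1) := by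
    intro m hm
    rw [Finset.mem_range, Nat.lt_succ_iff, Set.ncard_eq_toFinset_card _ h.finite_edgeSet]
    exact Finset.card_le_card (mem_matchingsWithin.1 hm).1
  rw [matchingSum, ← Finset.sum_fiberwise_of_maps_to hmaps, matchingPolynomial, map_sum]
  refine Finset.sum_congr rfl fun r _ => ?_
  rw [Finset.sum_congr rfl (g := fun _ => (-1) ^ r * z ^ (H.vertexSet.ncard - k * r))
    (fun m hm => by rw [(Finset.mem_filter.1 hm).2]), Finset.sum_const, nsmul_eq_mul, ← hnum]
  simp
  ring

theorem IsKGraph.degree_le_maxDegree {α : Type*} {H : Hypergraph α} {k : ℕ}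
    (h : H.IsKGraph k) {v : α} (hv : v ∈ H.vertexSet) : H.degree v ≤ H.maxDegree :=
  le_csSup (h.finite_vertexSet.image _).bddAbove ⟨v, hv, rfl⟩

theorem IsKGraph.card_starWithin {α : Type*} {H : Hypergraph α} {k : ℕ}
    (h : H.IsKGraph k) (v : α) :
    (starWithin h.finite_edgeSet.toFinset H.vertexSet v).card = H.degree v := by
  rw [degree, ← Set.ncard_coe_finset]
  congr 1
  ext e
  simp only [Finset.mem_coe, mem_starWithin, Set.Finite.mem_toFinset, Set.mem_ofPred_eq]
  exact ⟨fun he => ⟨he.1, he.2.1⟩,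
    fun he => ⟨he.1, he.2, H.edgeSet_subset_powerset_vertexSet he.1⟩⟩

/-- Since c^k = (k-1)d, the second term d / c^(k-1) equals c / (k-1). -/
theorem add_div_pow_rpow_eq {k : ℕ} (hk : 2 ≤ k) {d : ℝ} (hd : 0 < d) :
    ((k - 1) * d) ^ (1 / (k : ℝ)) + d / (((k - 1) * d) ^ (1 / (k : ℝ))) ^ (k - 1) =
      k / (k - 1) * ((k - 1) * d) ^ (1 / (k : ℝ)) := by
  have hk' : (2 : ℝ) ≤ k := by exact_mod_cast hk
  have hk1 : (0 : ℝ) < k - 1 := by linarith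
  have hpos : 0 < (k - 1) * d := mul_pos hk1 hd
  set c := ((k - 1) * d) ^ (1 / (k : ℝ)) with hc
  have hc0 : 0 < c := Real.rpow_pos_of_pos hpos _
  have hck : c ^ (k - 1) * c = (k - 1) * d := by
    rw [← pow_succ, Nat.sub_add_cancel (by omega), hc, one_div,
      Real.rpow_inv_natCast_pow hpos.le (by omega)]
  have hq : 0 < c ^ (k - 1) := pow_pos hc0 _
  have h1 : d / c ^ (k - 1) = c / (k - 1) := by
    rw [div_eq_div_iff hq.ne' hk1.ne']
    linarith
  rw [h1]
  field_simp
  ring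

end Hypergraph

open Hypergraph in
theorem theorem4p7 {α : Type*} (k : ℕ) (G : Hypergraph α) (hG : G.IsKGraph k)
    (hconn : G.IsConnected) (hdeg : 2 ≤ G.maxDegree) :
    G.matchingRadius k <
      (k : ℝ) / ((k : ℝ) - 1) *
        (((k : ℝ) - 1) * ((G.maxDegree : ℝ) - 1)) ^ (1 / (k : ℝ)) := by
  have hV : G.vertexSet.Nonempty := by
    rw [Set.nonempty_iff_ne_empty]
    intro h0
    -- With no vertices the supremum is `sSup ∅ = 0`, contradicting `2 ≤ G.maxDegree`.
    simp [maxDegree, h0] at hdeg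
  obtain ⟨z, hz0, hz⟩ := (hG.isGreatest_matchingRadius hV).1
  rw [hG.aeval_matchingPolynomial] at hz0
  have hk' : (2 : ℝ) ≤ k := by exact_mod_cast hG.two_le
  have hd : ((G.maxDegree - 1 : ℕ) : ℝ) = (G.maxDegree : ℝ) - 1 := by
    rw [Nat.cast_sub (by omega), Nat.cast_one]
  have hd1 : (1 : ℝ) ≤ (G.maxDegree : ℝ) - 1 := by
    rw [← hd]
    exact_mod_cast (by omega : 1 ≤ G.maxDegree - 1)
  by_contra! hle
  rw [← hz, ← add_div_pow_rpow_eq hG.two_le (by linarith), ← hd] at hle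
  refine (matchingSum_ne_zero_and_lt hG.two_le
    (fun e he => hG.ncard_edge e (hG.finite_edgeSet.mem_toFinset.1 he))
    (Real.one_le_rpow ?_ (by positivity)) (by omega) hle _ G.vertexSet hG.finite_vertexSet rfl
    fun v hv => ?_).1 hz0
  · rw [hd]
    nlinarith
  · rw [hG.card_starWithin]
    have := hG.degree_le_maxDegree hv
    omega
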